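/- For an odd prime $p$ let $$T(p)=\sqrt{p}\sum_{n=1}^{(p-1)/2}\tan\frac{\pi n^2}{p},\qquad C(p)=\sqrt{p}\sum_{n=1}^{(p-1)/2}\cot\frac{\pi n^2}{p},$$ and let $q_o(p)$ and $q_e(p)$ be, respectively, the number of odd and of even quadratic residues modulo $p$ in the set $\{1,2,\ldots,p-1\}$. Then: 1. $C(3)=1$. 2. For every prime $p\equiv 3\pmod 4$ with $p>3$, $C(p)$ is an odd positive integer that is divisible by $p$ and not divisible by $p^2$. 3. For every prime $p\equiv 3\pmod 8$, $T(p)$ is an integer that is a multiple of $3$. 4. For every prime $p\equiv 3\pmod 8$ with $p>3$, $q_o(p)-q_e(p)$ is a positive multiple of $3$. -/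

import Mathlib

/-- `T(p) = √p ∑_{n=1}^{(p-1)/2} tan (π n² / p)`. -/
noncomputable def tanSum (p : ℕ) : ℝ :=
  Real.sqrt (p : ℝ) *
    ∑ n ∈ Finset.Icc 1 ((p - 1) / 2), Real.tan (Real.pi * (n : ℝ) ^ 2 / (p : ℝ))

/-- `C(p) = √p ∑_{n=1}^{(p-1)/2} cot (π n² / p)`. -/
noncomputable def cotSum (p : ℕ) : ℝ :=
  Real.sqrt (p : ℝ) *
    ∑ n ∈ Finset.Icc 1 ((p - 1) / 2), Real.cot (Real.pi * (n : ℝ) ^ 2 / (p : ℝ))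

open Classical in
/-- The number `q_o(p)` of odd quadratic residues mod `p` in `{1, …, p - 1}`. -/
noncomputable def oddResidues (p : ℕ) : ℕ :=
  ((Finset.Icc 1 (p - 1)).filter (fun k : ℕ => Odd k ∧ IsSquare (k : ZMod p))).card

open Classical in
/-- The number `q_e(p)` of even quadratic residues mod `p` in `{1, …, p - 1}`. -/
noncomputable def evenResidues (p : ℕ) : ℕ :=
  ((Finset.Icc 1 (p - 1)).filter (fun k : ℕ => Even k ∧ IsSquare (k : ZMod p))).card

/-!
Let `χ` be the quadratic character modulo `p` and `M = ∑ j χ(j)`. For `p ≡ 3 (mod 4)` the character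
is odd, so summing an odd function over the squares amounts to pairing it with `χ`, and
`2 C(p) = √p ∑ χ(k) cot (π k / p)`. Expanding the cotangent in additive characters turns this into a
Gauss sum times `M`, and the value `i √p` of the Gauss sum gives `C(p) = -M`. The sign of the Gauss
sum is obtained by Kronecker's method: the Gauss sum and the product `∏ (ζ^a - ζ^(-a))` agree up to
sign, and the wrong sign is excluded by comparing the first nonvanishing coefficients in powers of
`X - 1`, modulo `p`, of the corresponding polynomials.

That `C(p)` is positive is the positivity of `L(1, χ)`, since `∑ χ(k) cot (π k / p)` is a positive
multiple of it. Divisibility by `p` is the vanishing modulo `p` of `∑ j^((p+1)/2)`, which is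
congruent to `M` by Euler's criterion, while `|M| < p^2` and the parity of `M` are elementary.
Finally `tan y = cot y - 2 cot (2 y)` and a comparison of the parity of `2 j mod p` with the size of
`j` give `T(p) = (1 - 2 χ(2)) C(p)` and `p (q_o(p) - q_e(p)) = (2 χ(2) - 1) M`; the factor `3`
appears because `χ(2) = -1` when `p ≡ 3 (mod 8)`.
-/

section CoeffPairing
open Polynomial

variable {R : Type*} [CommRing R]

/-- The linear functional `∑ cⱼ Xʲ ↦ ∑ cⱼ φ(j)` on polynomials. -/
noncomputable def coeffPairing (φ : R → R) : R[X] →ₗ[R] R :=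
  Polynomial.lsum fun j => LinearMap.mulRight R (φ j)

lemma coeffPairing_monomial (φ : R → R) (j : ℕ) (c : R) :
    coeffPairing φ (monomial j c) = c * φ j := by
  simp [coeffPairing, Polynomial.lsum_apply]

lemma coeffPairing_X_sub_one_mul (φ : R → R) (f : R[X]) :
    coeffPairing φ ((X - 1) * f) = coeffPairing (fwdDiff 1 φ) f := by
  induction f using Polynomial.induction_on' with
  | add f g hf hg => rw [mul_add, map_add, map_add, hf, hg]
  | monomial j c =>
    rw [sub_mul, one_mul, X_mul_monomial, map_sub, coeffPairing_monomial, coeffPairing_monomial,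
      coeffPairing_monomial, fwdDiff, Nat.cast_add_one, mul_sub]

lemma coeffPairing_X_sub_one_pow_mul (φ : R → R) (n : ℕ) (f : R[X]) :
    coeffPairing φ ((X - 1) ^ n * f) = coeffPairing ((fwdDiff 1)^[n] φ) f := by
  induction n generalizing φ with
  | zero => simp
  | succ n ih =>
    rw [pow_succ', mul_assoc, coeffPairing_X_sub_one_mul, ih, Function.iterate_succ_apply]

lemma coeffPairing_const (c : R) (f : R[X]) :
    coeffPairing (fun _ => c) f = f.eval 1 * c := by
  induction f using Polynomial.induction_on' with
  | add f g hf hg => rw [map_add, eval_add, add_mul, hf, hg]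
  | monomial j a => simp [coeffPairing_monomial]

lemma coeffPairing_pow_X_sub_one_pow_mul (n : ℕ) (f : R[X]) :
    coeffPairing (fun x : R => x ^ n) ((X - 1) ^ n * f) = n.factorial * f.eval 1 := by
  rw [coeffPairing_X_sub_one_pow_mul, fwdDiff_iter_eq_factorial, mul_comm]
  exact coeffPairing_const _ f

lemma coeffPairing_pow_X_sub_one_pow_mul_of_lt {j n : ℕ} (hjn : j < n) (f : R[X]) :
    coeffPairing (fun x : R => x ^ j) ((X - 1) ^ n * f) = 0 := by
  rw [coeffPairing_X_sub_one_pow_mul, fwdDiff_iter_pow_eq_zero_of_lt hjn]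
  exact (coeffPairing_const 0 f).trans (mul_zero _)

end CoeffPairing

section KroneckerProd
open Polynomial

variable (R : Type*) [CommRing R]

/-- Kronecker's product `∏_{1 ≤ k ≤ m} (X ^ (km) - X ^ (k(m+1)))`. For `2m + 1 = p` its value at
`exp (2πi / p)` is a product of sines, which fixes the sign of the Gauss sum. -/
noncomputable def kroneckerProd (m : ℕ) : R[X] :=
  ∏ k ∈ Finset.range m, (X ^ ((k + 1) * m) - X ^ ((k + 1) * (m + 1)))

lemma map_kroneckerProd {S : Type*} [CommRing S] (f : R →+* S) (m : ℕ) :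
    (kroneckerProd R m).map f = kroneckerProd S m := by
  simp [kroneckerProd, Polynomial.map_prod]

lemma exists_kroneckerProd_eq_X_sub_one_pow_mul (m : ℕ) :
    ∃ g : R[X], kroneckerProd R m = (X - 1) ^ m * g ∧ g.eval 1 = (-1) ^ m * m.factorial := by
  refine ⟨∏ k ∈ Finset.range m, -(X ^ ((k + 1) * m) * ∑ i ∈ Finset.range (k + 1), X ^ i), ?_, ?_⟩
  · have factor (k : ℕ) : (X : R[X]) ^ ((k + 1) * m) - X ^ ((k + 1) * (m + 1)) =
        (X - 1) * -(X ^ ((k + 1) * m) * ∑ i ∈ Finset.range (k + 1), X ^ i) := by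
      linear_combination X ^ ((k + 1) * m) * mul_geom_sum (X : R[X]) (k + 1)
    simp only [kroneckerProd, factor, Finset.prod_mul_distrib, Finset.prod_const, Finset.card_range]
  · simp [eval_prod, Finset.prod_neg, eval_finsetSum, ← Finset.prod_range_add_one_eq_factorial]

end KroneckerProd

section Kronecker
open Polynomial

variable {p : ℕ} [Fact p.Prime]

lemma neg_one_pow_mul_factorial_half_sq (hp : p ≠ 2) :
    (-1) ^ (p / 2) * ((p / 2).factorial : ZMod p) ^ 2 = -1 := by
  obtain ⟨m, hm⟩ := (Fact.out : p.Prime).odd_of_ne_two hp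
  have reflect : ∀ k ∈ Finset.range m, ((m + 1 + (m - 1 - k) : ℕ) : ZMod p) = -(k + 1 : ℕ) := by
    intro k hk
    rw [eq_neg_iff_add_eq_zero, ← Nat.cast_add, ← CharP.cast_eq_zero (ZMod p) p]
    congr 1
    grind
  calc (-1) ^ (p / 2) * ((p / 2).factorial : ZMod p) ^ 2
      = m.factorial * ∏ k ∈ Finset.range m, (-(k + 1 : ℕ) : ZMod p) := by
        rw [Finset.prod_neg, ← Nat.cast_prod, Finset.prod_range_add_one_eq_factorial,
          Finset.card_range, show p / 2 = m by omega]
        ring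
    _ = (m.factorial * (m + 1).ascFactorial m : ℕ) := by
        rw [Nat.ascFactorial_eq_prod_range, ← Finset.prod_range_reflect (m + 1 + ·), Nat.cast_mul,
          Nat.cast_prod, Finset.prod_congr rfl reflect]
    _ = -1 := by
        rw [Nat.factorial_mul_ascFactorial, ← ZMod.wilsons_lemma p, show p - 1 = m + m by omega]

lemma coeffPairing_kroneckerProd (hp : p ≠ 2) :
    coeffPairing (fun x => x ^ (p / 2)) (kroneckerProd (ZMod p) (p / 2)) = -1 := by
  obtain ⟨g, hg, hg1⟩ := exists_kroneckerProd_eq_X_sub_one_pow_mul (ZMod p) (p / 2)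
  rw [hg, coeffPairing_pow_X_sub_one_pow_mul, hg1]
  linear_combination neg_one_pow_mul_factorial_half_sq hp

variable (p) in
/-- The Fekete polynomial `∑ⱼ (j/p) Xʲ`, whose value at `exp (2πi / p)` is the Gauss sum. -/
noncomputable def feketePoly : ℤ[X] :=
  ∑ j : ZMod p, monomial j.val (quadraticChar (ZMod p) j)

lemma coeffPairing_feketePoly (hp : p ≠ 2) :
    coeffPairing (fun x => x ^ (p / 2)) ((feketePoly p).map (Int.castRingHom (ZMod p))) = -1 := by
  have hchar : ringChar (ZMod p) ≠ 2 := by rwa [ZMod.ringChar_zmod_n]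
  calc _ = ∑ j : ZMod p, (j ^ (p / 2)) * j ^ (p / 2) := by
        simp only [feketePoly, Polynomial.map_sum, map_monomial, map_sum, coeffPairing_monomial,
          eq_intCast, quadraticChar_eq_pow_of_char_ne_two' hchar, ZMod.card, ZMod.natCast_zmod_val]
    _ = ∑ j : ZMod p, j ^ (p - 1) := by
        simp only [← pow_add]
        have := (Fact.out : p.Prime).odd_of_ne_two hp
        congr! 2; grind
    _ = -1 := by
        simp [ZMod.pow_card_sub_one, Finset.filter_ne', Finset.sum_ite, Finset.card_erase_of_mem,
          ZMod.card, Nat.cast_pred (Fact.out : p.Prime).pos]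

lemma X_sub_one_pow_dvd_map_of_aeval_eq_zero {K : Type*} [Field K] [CharZero K] {ζ : K}
    (hζ : IsPrimitiveRoot ζ p) {f : ℤ[X]} (hf : aeval ζ f = 0) :
    (X - 1) ^ (p - 1) ∣ f.map (Int.castRingHom (ZMod p)) := by
  have hp : p.Prime := Fact.out
  have hdvd : cyclotomic p ℤ ∣ f := by
    rw [cyclotomic_eq_minpoly hζ hp.pos]
    exact minpoly.isIntegrallyClosed_dvd (hζ.isIntegral hp.pos) hf
  have hcyc := cyclotomic_mul_prime_eq_pow_of_not_dvd (ZMod p) hp.not_dvd_one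
  rw [one_mul, cyclotomic_one] at hcyc
  simpa [hcyc] using Polynomial.map_dvd (Int.castRingHom (ZMod p)) hdvd

lemma aeval_feketePoly_add_kroneckerProd_ne_zero {K : Type*} [Field K] [CharZero K] {ζ : K}
    (hζ : IsPrimitiveRoot ζ p) (hp : p ≠ 2) :
    aeval ζ (feketePoly p + kroneckerProd ℤ (p / 2)) ≠ 0 := by
  intro h
  have hp2 : 2 < p := (Fact.out : p.Prime).two_le.lt_of_ne' hp
  obtain ⟨g, hg⟩ := X_sub_one_pow_dvd_map_of_aeval_eq_zero hζ h
  have hpair : (-1 + -1 : ZMod p) = 0 := by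
    have := congrArg (coeffPairing fun x => x ^ (p / 2)) hg
    rwa [Polynomial.map_add, map_add, coeffPairing_feketePoly hp, map_kroneckerProd,
      coeffPairing_kroneckerProd hp,
      coeffPairing_pow_X_sub_one_pow_mul_of_lt (by omega)] at this
  have hchar : ringChar (ZMod p) ≠ 2 := by rwa [ZMod.ringChar_zmod_n]
  exact Ring.neg_one_ne_one_of_char_ne_two hchar (by linear_combination hpair)

end Kronecker

section GaussSum
open Polynomial Complex

lemma prod_two_mul_sin (n : ℕ) :
    ∏ k ∈ Finset.range n, (2 * Real.sin (Real.pi * (k + 1) / (n + 1))) = n + 1 := by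
  have hprod := (Complex.isPrimitiveRoot_exp (n + 1) n.succ_ne_zero).prod_one_sub_pow_eq_order
  have hsin : ∀ k ∈ Finset.range n, ‖1 - exp (2 * Real.pi * I / (n + 1 : ℕ)) ^ (k + 1)‖ =
      2 * Real.sin (Real.pi * (k + 1) / (n + 1)) := by
    intro k hk
    have hk' : (k + 1 : ℝ) ≤ n + 1 := by exact_mod_cast (by grind : k + 1 ≤ n + 1)
    have hsin_nonneg : 0 ≤ Real.sin (Real.pi * (k + 1) / (n + 1)) :=
      Real.sin_nonneg_of_nonneg_of_le_pi (by positivity)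
        (div_le_of_le_mul₀ (by positivity) Real.pi_pos.le (by gcongr))
    have hexp : exp (2 * Real.pi * I / (n + 1 : ℕ)) ^ (k + 1) =
        exp (I * ↑(2 * (Real.pi * (k + 1) / (n + 1)))) := by
      rw [← exp_nat_mul]; push_cast; ring_nf
    rw [norm_sub_rev, hexp, norm_exp_I_mul_ofReal_sub_one, mul_div_cancel_left₀ _ two_ne_zero,
      Real.norm_of_nonneg (by positivity)]
  rw [← Finset.prod_congr rfl hsin, ← norm_prod, hprod]
  exact_mod_cast norm_natCast (n + 1)

lemma prod_two_mul_sin_half (m : ℕ) :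
    ∏ k ∈ Finset.range m, (2 * Real.sin (Real.pi * (k + 1) / (2 * m + 1))) =
      √(2 * m + 1) := by
  have hfull := prod_two_mul_sin (m + m)
  have reflect : ∀ k ∈ Finset.range m,
      2 * Real.sin (Real.pi * ((m + (m - 1 - k) : ℕ) + 1) / ((m + m : ℕ) + 1)) =
        2 * Real.sin (Real.pi * (k + 1) / (2 * m + 1)) := by
    intro k hk
    have hk' : ((m + (m - 1 - k) : ℕ) : ℝ) + 1 = 2 * m + 1 - (k + 1) := by
      rw [eq_sub_iff_add_eq]; exact_mod_cast (by grind)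
    rw [hk', ← Real.sin_pi_sub (Real.pi * (k + 1) / (2 * m + 1))]
    congr 2
    push_cast
    field_simp
    ring
  have hnonneg : 0 ≤ ∏ k ∈ Finset.range m, (2 * Real.sin (Real.pi * (k + 1) / (2 * m + 1))) := by
    refine Finset.prod_nonneg fun k hk => mul_nonneg two_pos.le
      (Real.sin_nonneg_of_nonneg_of_le_pi (by positivity)
        (div_le_of_le_mul₀ (by positivity) Real.pi_pos.le ?_))
    gcongr
    exact_mod_cast (by grind : k ≤ 2 * m)
  rw [Finset.prod_range_add, ← Finset.prod_range_reflect (fun k =>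
      2 * Real.sin (Real.pi * ((m + k : ℕ) + 1) / ((m + m : ℕ) + 1))),
    Finset.prod_congr rfl reflect] at hfull
  rw [eq_comm, Real.sqrt_eq_iff_mul_self_eq (by positivity) hnonneg]
  push_cast [← two_mul] at hfull
  exact hfull.symm

lemma prod_neg_one_pow_mul_I (m : ℕ) :
    ∏ k ∈ Finset.range m, ((-1) ^ k * I) = if Even m then 1 else I := by
  induction m with
  | zero => simp
  | succ m ih =>
    rw [Finset.prod_range_succ, ih]
    rcases Nat.even_or_odd m with hm | hm
    · simp [hm, hm.neg_one_pow, Nat.even_add_one]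
    · simp [Nat.not_even_iff_odd.2 hm, hm.neg_one_pow, Nat.even_add_one]

lemma exp_pow_mul_sub_exp_pow_mul (a m : ℕ) :
    exp (2 * Real.pi * I / (2 * m + 1 : ℕ)) ^ ((a + 1) * m) -
        exp (2 * Real.pi * I / (2 * m + 1 : ℕ)) ^ ((a + 1) * (m + 1)) =
      (-1) ^ a * I * (2 * Real.sin (Real.pi * (a + 1) / (2 * m + 1)) : ℝ) := by
  set θ : ℂ := Real.pi * (a + 1) / (2 * m + 1) with hθ
  have hm : (m * 2 + 1 : ℂ) ≠ 0 := by exact_mod_cast (m * 2).succ_ne_zero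
  have hexp_pi : exp ((a + 1 : ℕ) * (Real.pi * I)) = (-1) ^ (a + 1) := by
    rw [exp_nat_mul, exp_pi_mul_I]
  have hleft : exp (2 * Real.pi * I / (2 * m + 1 : ℕ)) ^ ((a + 1) * m) =
      (-1) ^ (a + 1) * exp (-θ * I) := by
    rw [← hexp_pi, ← exp_add, ← exp_nat_mul, hθ]
    congr 1; push_cast; field_simp; ring
  have hright : exp (2 * Real.pi * I / (2 * m + 1 : ℕ)) ^ ((a + 1) * (m + 1)) =
      (-1) ^ (a + 1) * exp (θ * I) := by
    rw [← hexp_pi, ← exp_add, ← exp_nat_mul, hθ]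
    congr 1; push_cast; field_simp; ring
  have hsin : ((2 * Real.sin (Real.pi * (a + 1) / (2 * m + 1)) : ℝ) : ℂ) = 2 * sin θ := by
    push_cast [hθ]; rfl
  rw [hleft, hright, hsin, two_sin]
  linear_combination (-1 : ℂ) ^ a * (exp (θ * I) - exp (-θ * I)) * I_mul_I

lemma aeval_kroneckerProd (m : ℕ) :
    aeval (exp (2 * Real.pi * I / (2 * m + 1 : ℕ))) (kroneckerProd ℤ m) =
      (if Even m then 1 else I) * √(2 * m + 1 : ℕ) := by
  simp only [kroneckerProd, map_prod, map_sub, map_pow, aeval_X, exp_pow_mul_sub_exp_pow_mul]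
  rw [Finset.prod_mul_distrib, prod_neg_one_pow_mul_I, ← ofReal_prod, prod_two_mul_sin_half]
  norm_cast

variable {p : ℕ} [Fact p.Prime]

variable (p) in
/-- The quadratic character modulo `p` with values in `ℂ`. -/
noncomputable def quadCharC : DirichletCharacter ℂ p :=
  (quadraticChar (ZMod p)).ringHomComp (Int.castRingHom ℂ)

lemma quadCharC_apply (j : ZMod p) : quadCharC p j = (quadraticChar (ZMod p) j : ℤ) := rfl

lemma quadCharC_isQuadratic : (quadCharC p).IsQuadratic :=
  (quadraticChar_isQuadratic (ZMod p)).comp _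

lemma quadCharC_ne_one (hp : p ≠ 2) : quadCharC p ≠ 1 :=
  (MulChar.ringHomComp_ne_one_iff (RingHom.injective_int _)).2 <|
    quadraticChar_ne_one (by rwa [ZMod.ringChar_zmod_n])

lemma stdAddChar_eq_exp_pow {N : ℕ} [NeZero N] (j : ZMod N) :
    ZMod.stdAddChar j = exp (2 * Real.pi * I / N) ^ j.val := by
  conv_lhs => rw [← ZMod.natCast_zmod_val j]
  rw [← Int.cast_natCast, ZMod.stdAddChar_coe, ← exp_nat_mul]
  congr 1
  push_cast
  ring

lemma gaussSum_quadCharC_eq_aeval_feketePoly :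
    gaussSum (quadCharC p) ZMod.stdAddChar = aeval (exp (2 * Real.pi * I / p)) (feketePoly p) := by
  simp [gaussSum, feketePoly, stdAddChar_eq_exp_pow, quadCharC_apply, aeval_monomial]

theorem gaussSum_quadCharC (hp : p ≠ 2) :
    gaussSum (quadCharC p) ZMod.stdAddChar = (if p % 4 = 1 then 1 else I) * √p := by
  have hprime : p.Prime := Fact.out
  have hpm : 2 * (p / 2) + 1 = p := by have := hprime.odd_of_ne_two hp; grind
  have heven : Even (p / 2) ↔ p % 4 = 1 := by grind
  set B : ℂ := (if p % 4 = 1 then 1 else I) * √p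
  have hB : aeval (exp (2 * Real.pi * I / p)) (kroneckerProd ℤ (p / 2)) = B := by
    have := aeval_kroneckerProd (p / 2)
    rwa [hpm, if_congr heven rfl rfl] at this
  have hne : gaussSum (quadCharC p) ZMod.stdAddChar ≠ -B := by
    have := aeval_feketePoly_add_kroneckerProd_ne_zero
      (Complex.isPrimitiveRoot_exp p hprime.ne_zero) hp
    rwa [map_add, ← gaussSum_quadCharC_eq_aeval_feketePoly, hB, Ne, add_eq_zero_iff_eq_neg] at this
  refine (sq_eq_sq_iff_eq_or_eq_neg.1 ?_).resolve_right hne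
  rw [gaussSum_sq (χ := quadCharC p) (quadCharC_ne_one hp) quadCharC_isQuadratic
      (ZMod.isPrimitive_stdAddChar p), quadCharC_apply,
    quadraticChar_neg_one (by rwa [ZMod.ringChar_zmod_n]), ZMod.card, mul_pow, ← ofReal_pow,
    Real.sq_sqrt p.cast_nonneg]
  rcases (by omega : p % 4 = 1 ∨ p % 4 = 3) with h | h
  · simp [h, ZMod.χ₄_nat_one_mod_four h]
  · simp [h, ZMod.χ₄_nat_three_mod_four h]

end GaussSum

section HurwitzOdd
open Filter Topology HurwitzZeta Set

lemma abs_one_div_rpow_sub_one_div_rpow_le {a b s : ℝ} (ha : 0 < a) (hb : 0 < b) (hs : 1 ≤ s) :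
    |1 / a ^ s - 1 / b ^ s| ≤ s * |b - a| / min a b ^ (s + 1) := by
  wlog hab : a ≤ b generalizing a b
  · rw [abs_sub_comm, abs_sub_comm b a, min_comm]
    exact this hb ha (le_of_not_ge hab)
  have hratio : 0 < a / b := div_pos ha hb
  have bernoulli : 1 - (a / b) ^ s ≤ s * (b - a) / a :=
    calc 1 - (a / b) ^ s ≤ s * (1 - a / b) := by
          have := one_add_mul_self_le_rpow_one_add (s := a / b - 1) (by linarith) hs
          rw [add_sub_cancel] at this
          linarith
      _ = s * (b - a) / b := by field_simp
      _ ≤ s * (b - a) / a := by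
          have : 0 ≤ b - a := sub_nonneg.2 hab
          gcongr
  rw [min_eq_left hab, abs_of_nonneg (sub_nonneg.2 hab),
    abs_of_nonneg (sub_nonneg.2 (by gcongr)), Real.rpow_add_one ha.ne']
  calc 1 / a ^ s - 1 / b ^ s = 1 / a ^ s * (1 - (a / b) ^ s) := by
        rw [Real.div_rpow ha.le hb.le]; field_simp
    _ ≤ 1 / a ^ s * (s * (b - a) / a) := by gcongr
    _ = s * (b - a) / (a ^ s * a) := by field_simp

lemma pow_mul_pow_le_rpow {c t y s : ℝ} {k m : ℕ} (hc : 0 < c) (hc1 : c ≤ 1) (ht : 1 ≤ t)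
    (hty : c * t ≤ y) (hks : k ≤ s) (hsm : s ≤ m) : c ^ m * t ^ k ≤ y ^ s := by
  have ht0 : 0 < t := by linarith
  calc c ^ m * t ^ k ≤ c ^ s * t ^ s := by
        rw [← Real.rpow_natCast, ← Real.rpow_natCast]
        exact mul_le_mul (Real.rpow_le_rpow_of_exponent_ge hc hc1 hsm)
          (Real.rpow_le_rpow_of_exponent_le ht hks) (by positivity) (by positivity)
    _ = (c * t) ^ s := (Real.mul_rpow hc.le ht0.le).symm
    _ ≤ y ^ s := Real.rpow_le_rpow (by positivity) hty (k.cast_nonneg.trans hks)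

lemma abs_one_div_nat_add_rpow_sub_le {x s : ℝ} (hx : x ∈ Ioo 0 1) (hs : s ∈ Icc 1 2) (n : ℕ) :
    |1 / ((n : ℝ) + x) ^ s - 1 / ((n : ℝ) + 1 - x) ^ s| ≤
      2 / min x (1 - x) ^ 3 * (1 / ((n : ℝ) + 1) ^ 2) := by
  obtain ⟨hx0, hx1⟩ := hx
  have hx1' : 0 < 1 - x := sub_pos.2 hx1
  set c := min x (1 - x) with hc
  have hc0 : 0 < c := lt_min hx0 hx1'
  have hc1 : c ≤ 1 := (min_le_left _ _).trans hx1.le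
  have hdist : |(n : ℝ) + (1 - x) - (n + x)| ≤ 1 := by rw [abs_le]; constructor <;> linarith
  have hle : c * (n + 1) ≤ n + c := by nlinarith [n.cast_nonneg (α := ℝ)]
  have hden : c ^ 3 * ((n : ℝ) + 1) ^ 2 ≤ (n + c) ^ (s + 1) :=
    pow_mul_pow_le_rpow hc0 hc1 (by simp) hle (by push_cast; linarith [hs.1])
      (by push_cast; linarith [hs.2])
  rw [add_sub_assoc]
  calc _ ≤ s * |(n : ℝ) + (1 - x) - (n + x)| / min (n + x) (n + (1 - x)) ^ (s + 1) :=
        abs_one_div_rpow_sub_one_div_rpow_le (by positivity) (by positivity) hs.1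
    _ ≤ 2 * 1 / (c ^ 3 * ((n : ℝ) + 1) ^ 2) := by
        rw [min_add_add_left, ← hc]
        gcongr
        exact hs.2
    _ = 2 / c ^ 3 * (1 / ((n : ℝ) + 1) ^ 2) := by field_simp

lemma hasSum_one_div_nat_add_sub_one_div_nat_succ_add {x : ℝ} (hx : 0 < x) :
    HasSum (fun n : ℕ => 1 / ((n : ℝ) + x) - 1 / ((n + 1 : ℕ) + x)) (1 / x) := by
  have htail : Tendsto (fun n : ℕ => 1 / ((n : ℝ) + x)) atTop (𝓝 0) :=
    tendsto_const_nhds.div_atTop (tendsto_atTop_add_const_right _ _ tendsto_natCast_atTop_atTop)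
  have hnonneg (n : ℕ) : 0 ≤ 1 / ((n : ℝ) + x) - 1 / ((n + 1 : ℕ) + x) :=
    sub_nonneg.2 (by gcongr; exact n.le_succ)
  rw [hasSum_iff_tendsto_nat_of_nonneg hnonneg]
  simp only [Finset.sum_range_sub' (fun n : ℕ => 1 / ((n : ℝ) + x)), Nat.cast_zero, zero_add]
  simpa using tendsto_const_nhds.sub htail

lemma hasSum_one_div_nat_add_sub_one_div_nat_add_one_sub {x : ℝ} (hx : x ∈ Ioo 0 1) :
    HasSum (fun n : ℕ => 1 / ((n : ℝ) + x) - 1 / ((n : ℝ) + 1 - x))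
      (Real.pi * Real.cot (Real.pi * x)) := by
  have hxZ : (x : ℂ) ∈ Complex.integerComplement := by
    rintro ⟨k, hk⟩
    have hk : (k : ℝ) = x := by exact_mod_cast hk
    rw [← hk] at hx
    have hk0 : 0 < k := by exact_mod_cast hx.1
    have hk1 : k < 1 := by exact_mod_cast hx.2
    omega
  have hcot : HasSum (fun n : ℕ => 1 / (x - ((n : ℝ) + 1)) + 1 / (x + ((n : ℝ) + 1)))
      (Real.pi * Real.cot (Real.pi * x) - 1 / x) := by
    have := (summable_cotTerm hxZ).hasSum
    rw [← cot_series_rep' hxZ] at this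
    rw [← Complex.hasSum_ofReal]
    push_cast
    exact this
  convert hcot.add (hasSum_one_div_nat_add_sub_one_div_nat_succ_add hx.1) using 2 with n
  · rw [← neg_sub ((n : ℝ) + 1), one_div_neg_eq_neg_one_div]
    push_cast
    ring
  · ring

lemma tendsto_tsum_one_div_nat_add_rpow_sub {x : ℝ} (hx : x ∈ Ioo 0 1) :
    Tendsto (fun s : ℝ => ∑' n : ℕ, (1 / ((n : ℝ) + x) ^ s - 1 / ((n : ℝ) + 1 - x) ^ s)) (𝓝[>] 1)
      (𝓝 (Real.pi * Real.cot (Real.pi * x))) := by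
  rw [← (hasSum_one_div_nat_add_sub_one_div_nat_add_one_sub hx).tsum_eq]
  have hbound : Summable fun n : ℕ => 2 / min x (1 - x) ^ 3 * (1 / ((n : ℝ) + 1) ^ 2) := by
    refine Summable.mul_left _ ?_
    exact_mod_cast (summable_nat_add_iff 1).2 (Real.summable_one_div_nat_pow.2 one_lt_two)
  refine tendsto_tsum_of_dominated_convergence hbound (fun n => ?_) ?_
  · have ha : (n : ℝ) + x ≠ 0 := by have := hx.1; positivity
    have hb : (n : ℝ) + 1 - x ≠ 0 := by
      have := sub_pos.2 hx.2; rw [add_sub_assoc]; positivity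
    have hcont : ContinuousAt
        (fun s : ℝ => 1 / ((n : ℝ) + x) ^ s - 1 / ((n : ℝ) + 1 - x) ^ s) 1 := by
      refine (continuousAt_const.div (Real.continuousAt_const_rpow ha) ?_).sub
        (continuousAt_const.div (Real.continuousAt_const_rpow hb) ?_) <;> simpa
    simpa only [Real.rpow_one] using hcont.tendsto.mono_left nhdsWithin_le_nhds
  · filter_upwards [Ioo_mem_nhdsGT one_lt_two] with s hs n
    exact abs_one_div_nat_add_rpow_sub_le hx (Ioo_subset_Icc_self hs) n

theorem hurwitzZetaOdd_one {x : ℝ} (hx : x ∈ Ioo 0 1) :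
    hurwitzZetaOdd x 1 = (Real.pi / 2 * Real.cot (Real.pi * x) : ℝ) := by
  have hcont : Continuous fun s : ℝ => hurwitzZetaOdd x s :=
    (differentiable_hurwitzZetaOdd _).continuous.comp Complex.continuous_ofReal
  have hlim : Tendsto (fun s : ℝ => hurwitzZetaOdd x s) (𝓝[>] 1) (𝓝 (hurwitzZetaOdd x 1)) := by
    simpa using (hcont.tendsto 1).mono_left nhdsWithin_le_nhds
  have hseries := (Complex.continuous_ofReal.tendsto _).comp
    ((tendsto_tsum_one_div_nat_add_rpow_sub hx).div_const 2)
  rw [← mul_div_right_comm]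
  refine tendsto_nhds_unique hlim (hseries.congr' ?_)
  filter_upwards [self_mem_nhdsWithin] with s hs
  have hsum := hasSum_nat_hurwitzZetaOdd_of_mem_Icc (Ioo_subset_Icc_self hx)
    (s := s) (by simpa using hs)
  rw [Function.comp_apply, ← hsum.tsum_eq, ← tsum_div_const, Complex.ofReal_tsum]
  refine tsum_congr fun n => ?_
  have := hx.1
  have := hx.2
  push_cast
  rw [Complex.ofReal_cpow (by positivity),
    Complex.ofReal_cpow (by linarith [n.cast_nonneg (α := ℝ)])]
  push_cast
  rfl

end HurwitzOdd

section LFunctionOne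
open Filter Topology HurwitzZeta DirichletCharacter
open scoped ComplexOrder

variable {N : ℕ}

lemma LSeries_nonneg_of_isQuadratic {χ : DirichletCharacter ℂ N} (hχ : χ.IsQuadratic) {s : ℝ}
    (hs : 1 < s) : 0 ≤ LSeries (fun n => χ n) s := by
  refine ge_of_tendsto' (LSeries_eulerProduct_hasProd χ (s := s) (by simpa using hs)) fun t =>
    Finset.prod_nonneg fun q _ => ?_
  have hq : (1 : ℝ) ≤ (q : ℕ) := by exact_mod_cast q.2.one_le
  have hr0 : 0 ≤ ((q : ℕ) : ℝ) ^ (-s) := by positivity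
  have hr1 : ((q : ℕ) : ℝ) ^ (-s) ≤ 1 := Real.rpow_le_one_of_one_le_of_nonpos hq (by linarith)
  have hcast : ((q : ℕ) : ℂ) ^ (-s : ℂ) = (((q : ℕ) : ℝ) ^ (-s) : ℝ) := by
    rw [Complex.ofReal_cpow (by positivity)]; push_cast; rfl
  rw [hcast]
  obtain ⟨ε, hε, hχq⟩ : ∃ ε : ℝ, ε ≤ 1 ∧ χ (q : ℕ) = ε := by
    rcases hχ (q : ℕ) with h | h | h <;> rw [h]
    exacts [⟨0, zero_le_one, by simp⟩, ⟨1, le_rfl, by simp⟩, ⟨-1, by norm_num, by simp⟩]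
  rw [hχq]
  norm_cast
  exact inv_nonneg.2 (sub_nonneg.2 (mul_le_one₀ hε hr0 hr1))

variable [NeZero N]

lemma LFunction_one_pos_of_isQuadratic {χ : DirichletCharacter ℂ N} (hχ : χ.IsQuadratic)
    (hχ1 : χ ≠ 1) : 0 < LFunction χ 1 := by
  refine lt_of_le_of_ne ?_ (LFunction_apply_one_ne_zero hχ1).symm
  have hcont : Continuous fun s : ℝ => LFunction χ s :=
    (differentiable_LFunction hχ1).continuous.comp Complex.continuous_ofReal
  have hlim : Tendsto (fun s : ℝ => LFunction χ s) (𝓝[>] 1) (𝓝 (LFunction χ 1)) := by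
    simpa using (hcont.tendsto 1).mono_left nhdsWithin_le_nhds
  refine ge_of_tendsto hlim ?_
  filter_upwards [self_mem_nhdsWithin] with s hs
  rw [LFunction_eq_LSeries χ (by simpa using hs)]
  exact LSeries_nonneg_of_isQuadratic hχ hs

/-- The function `k ↦ cot (π k / N)` on residues mod `N`; at `k = 0` its value is `cot 0 = 0`. -/
noncomputable def cotRes (N : ℕ) (k : ZMod N) : ℝ := Real.cot (Real.pi * k.val / N)

lemma LFunction_one_eq_sum_mul_cotRes {Φ : ZMod N → ℂ} (hΦ : Function.Odd Φ) :
    ZMod.LFunction Φ 1 = (Real.pi / (2 * N) : ℝ) * ∑ k, Φ k * cotRes N k := by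
  rw [ZMod.LFunction_def_odd hΦ, Complex.cpow_neg_one, Finset.mul_sum, Finset.mul_sum]
  refine Finset.sum_congr rfl fun k _ => ?_
  rcases eq_or_ne k 0 with rfl | hk
  · simp [hΦ.map_zero]
  have hval : (k.val : ℝ) / N ∈ Set.Ioo 0 1 := by
    have hN : (0 : ℝ) < N := Nat.cast_pos'.2 (NeZero.pos N)
    have hk0 : 0 < k.val := ZMod.val_pos.2 hk
    exact ⟨by positivity, (div_lt_one hN).2 (by exact_mod_cast k.val_lt)⟩
  rw [ZMod.toAddCircle_apply, hurwitzZetaOdd_one hval, cotRes, mul_div_assoc]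
  push_cast
  ring

lemma sum_mul_cotRes_pos_of_isQuadratic {χ : DirichletCharacter ℂ N} (hχ : χ.IsQuadratic)
    (hodd : χ.Odd) : 0 < ∑ k, χ k * cotRes N k := by
  have hχ1 : χ ≠ 1 := by
    rintro rfl
    norm_num [DirichletCharacter.Odd, MulChar.one_apply] at hodd
  have hL := LFunction_one_pos_of_isQuadratic hχ hχ1
  rw [LFunction, LFunction_one_eq_sum_mul_cotRes hodd.to_fun] at hL
  refine pos_of_mul_pos_right hL ?_
  rw [Complex.zero_le_real]
  positivity

end LFunctionOne

section CotangentFourier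
open Complex ZMod
open scoped ZMod

lemma sum_range_natCast_mul_pow {K : Type*} [Field K] {z : K} {n : ℕ} (hz : z ≠ 1)
    (hzn : z ^ n = 1) : ∑ j ∈ Finset.range n, (j : K) * z ^ j = n / (z - 1) := by
  have htele (m : ℕ) : (∑ j ∈ Finset.range m, (j : K) * z ^ j) * (z - 1) =
      m * z ^ m - z * ∑ j ∈ Finset.range m, z ^ j := by
    induction m with
    | zero => simp
    | succ m ih =>
      rw [Finset.sum_range_succ, add_mul, ih, Finset.sum_range_succ]
      push_cast
      ring
  have hgeom : ∑ j ∈ Finset.range n, z ^ j = 0 := by rw [geom_sum_eq hz, hzn, sub_self, zero_div]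
  rw [eq_div_iff (sub_ne_zero.2 hz), htele, hgeom, hzn, mul_zero, sub_zero, mul_one]

variable {N : ℕ} [NeZero N]

lemma sum_eq_sum_range_natCast {M : Type*} [AddCommMonoid M] (g : ZMod N → M) :
    ∑ x, g x = ∑ n ∈ Finset.range N, g n := by
  refine Finset.sum_bij' (fun x _ => x.val) (fun n _ => (n : ZMod N)) ?_ ?_ ?_ ?_ ?_
  · exact fun x _ => Finset.mem_range.2 x.val_lt
  · exact fun _ _ => Finset.mem_univ _
  · exact fun x _ => natCast_zmod_val x
  · exact fun n hn => val_cast_of_lt (Finset.mem_range.1 hn)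
  · exact fun x _ => by rw [natCast_zmod_val]

lemma sum_val_mul_stdAddChar {k : ZMod N} (hk : k ≠ 0) :
    ∑ j : ZMod N, (j.val : ℂ) * stdAddChar (j * k) = N / (stdAddChar k - 1) := by
  have hpow (n : ℕ) : (stdAddChar ((n : ZMod N) * k) : ℂ) = stdAddChar k ^ n := by
    rw [← nsmul_eq_mul, AddChar.map_nsmul_eq_pow]
  have hne : (stdAddChar k : ℂ) ≠ 1 := by
    rw [← AddChar.map_zero_eq_one (stdAddChar (N := N))]
    exact injective_stdAddChar.ne hk
  rw [← sum_range_natCast_mul_pow hne (by rw [← hpow]; simp), sum_eq_sum_range_natCast]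
  refine Finset.sum_congr rfl fun j hj => ?_
  rw [val_cast_of_lt (Finset.mem_range.1 hj), hpow]

lemma cotRes_eq_sum_val_mul_stdAddChar {k : ZMod N} (hk : k ≠ 0) :
    (cotRes N k : ℂ) = I * (1 + 2 / N * ∑ j : ZMod N, (j.val : ℂ) * stdAddChar (j * k)) := by
  have hN : (N : ℂ) ≠ 0 := NeZero.ne _
  have hne : (stdAddChar k : ℂ) - 1 ≠ 0 := by
    rw [sub_ne_zero, ← AddChar.map_zero_eq_one (stdAddChar (N := N))]
    exact injective_stdAddChar.ne hk
  have hne' : 1 - (stdAddChar k : ℂ) ≠ 0 := by rwa [← neg_sub, neg_ne_zero]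
  have hexp : exp (2 * Real.pi * I * (k.val / N)) = stdAddChar k := by
    rw [stdAddChar_eq_exp_pow, ← exp_nat_mul]
    congr 1
    ring
  rw [cotRes, mul_div_assoc, ofReal_cot]
  push_cast
  rw [cot_pi_eq_exp_ratio, hexp, sum_val_mul_stdAddChar hk, div_eq_iff (mul_ne_zero I_ne_zero hne')]
  field_simp
  linear_combination ((stdAddChar k : ℂ) ^ 2 - 1) * I_sq

lemma sum_mul_cotRes_eq_sum_val_mul_dft {Φ : ZMod N → ℂ} (hΦ : Function.Odd Φ) :
    ∑ k, Φ k * cotRes N k = -(2 * I / N) * ∑ j : ZMod N, (j.val : ℂ) * 𝓕 Φ j := by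
  have hterm (k : ZMod N) : Φ k * cotRes N k =
      I * Φ k + 2 * I / N * ∑ j : ZMod N, (j.val : ℂ) * (stdAddChar (j * k) * Φ k) := by
    rcases eq_or_ne k 0 with rfl | hk
    · simp [hΦ.map_zero]
    · simp only [cotRes_eq_sum_val_mul_stdAddChar hk, ← mul_assoc, ← Finset.sum_mul]
      ring
  have hdft (j : ZMod N) : ∑ k, stdAddChar (j * k) * Φ k = -𝓕 Φ j := by
    rw [← dft_odd_iff.2 hΦ j, dft_apply]
    simp [mul_comm j]
  simp only [hterm, Finset.sum_add_distrib, ← Finset.mul_sum, hΦ.sum_eq_zero]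
  rw [Finset.sum_comm]
  simp only [← Finset.mul_sum, hdft, mul_neg, Finset.sum_neg_distrib]
  ring

lemma sum_mul_cotRes_of_isPrimitive {χ : DirichletCharacter ℂ N} (hχ : χ.IsPrimitive)
    (hodd : χ.Odd) :
    ∑ k, χ k * cotRes N k =
      2 * I / N * gaussSum χ stdAddChar * ∑ j : ZMod N, χ⁻¹ j * (j.val : ℂ) := by
  have hneg (j : ZMod N) : χ⁻¹ (-j) = -χ⁻¹ j := by
    rw [← neg_one_mul, map_mul, MulChar.inv_apply_eq_inv', hodd, inv_neg, inv_one, neg_one_mul]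
  rw [sum_mul_cotRes_eq_sum_val_mul_dft hodd.to_fun, Finset.mul_sum, Finset.mul_sum]
  refine Finset.sum_congr rfl fun j _ => ?_
  rw [hχ.fourierTransform_eq_inv_mul_gaussSum, hneg]
  ring

end CotangentFourier

section QuadraticSums

lemma sum_eq_add_two_nsmul_sum_Icc_of_even {N : ℕ} (hN : Odd N) [NeZero N] {M : Type*}
    [AddCommMonoid M] {g : ZMod N → M} (hg : Function.Even g) :
    ∑ x, g x = g 0 + 2 • ∑ n ∈ Finset.Icc 1 ((N - 1) / 2), g n := by
  obtain ⟨m, hm⟩ := hN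
  have hIcc : Finset.Icc 1 ((N - 1) / 2) = Finset.Ico 1 (m + 1) := by ext n; simp; omega
  have hreflect : ∑ n ∈ Finset.Ico (m + 1) N, g n = ∑ n ∈ Finset.Ico 1 (m + 1), g n := by
    rw [show Finset.Ico (m + 1) N = Finset.Ico (N + 1 - (m + 1)) (N + 1 - 1) by congr 1; omega,
      ← Finset.sum_Ico_reflect _ _ (by omega)]
    refine Finset.sum_congr rfl fun n hn => ?_
    rw [Nat.cast_sub (by grind), ZMod.natCast_self, zero_sub, hg]
  rw [sum_eq_sum_range_natCast, Finset.range_eq_Ico, Finset.sum_eq_sum_Ico_succ_bot (NeZero.pos N),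
    ← Finset.sum_Ico_consecutive _ (show 0 + 1 ≤ m + 1 by omega) (by omega), hreflect, hIcc,
    two_nsmul, Nat.cast_zero]

variable {F : Type*} [Field F] [Fintype F] [DecidableEq F] {R : Type*} [CommRing R]

lemma sum_comp_sq_eq_sum_quadraticChar_add_one_mul (hF : ringChar F ≠ 2) (f : F → R) :
    ∑ x, f (x ^ 2) = ∑ k, (quadraticChar F k + 1 : ℤ) * f k := by
  rw [← Finset.sum_fiberwise Finset.univ (fun x : F => x ^ 2)]
  refine Finset.sum_congr rfl fun k _ => ?_
  rw [← quadraticChar_card_sqrts hF, Finset.sum_congr rfl fun x hx => by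
    rw [(Finset.mem_filter.1 hx).2], Finset.sum_const, nsmul_eq_mul, Int.cast_natCast]
  congr 3
  ext x
  simp

lemma sum_quadraticChar_mul_eq_two_mul_sum_isSquare [IsAddTorsionFree R]
    [DecidablePred (IsSquare (α := F))] {f : F → R} (hf : Function.Odd f) :
    ∑ k, (quadraticChar F k : R) * f k = 2 * ∑ k with IsSquare k, f k := by
  rw [← add_zero (∑ k, _), ← hf.sum_eq_zero, ← Finset.sum_add_distrib, Finset.mul_sum,
    Finset.sum_filter]
  refine Finset.sum_congr rfl fun k _ => ?_
  rcases eq_or_ne k 0 with rfl | hk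
  · simp [hf.map_zero]
  split_ifs with hsq
  · rw [(quadraticChar_one_iff_isSquare hk).2 hsq, Int.cast_one, one_mul, two_mul]
  · rw [quadraticChar_neg_one_iff_not_isSquare.2 hsq]
    simp

lemma sum_quadraticChar_mul_comp_mul_left {a : F} (ha : a ≠ 0) (f : F → R) :
    ∑ k, (quadraticChar F k : R) * f (a * k) =
      quadraticChar F a * ∑ k, (quadraticChar F k : R) * f k := by
  rw [← Equiv.sum_comp (Equiv.mulLeft₀ a ha) fun k => (quadraticChar F k : R) * f k,
    Finset.mul_sum]
  refine Finset.sum_congr rfl fun k _ => ?_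
  rw [Equiv.mulLeft₀_apply, map_mul, Int.cast_mul, ← mul_assoc, ← mul_assoc, ← Int.cast_mul, ← sq,
    quadraticChar_sq_one ha, Int.cast_one, one_mul]

variable {p : ℕ} [Fact p.Prime]

lemma two_mul_sum_Icc_comp_sq [IsAddTorsionFree R] (hp : p ≠ 2) {f : ZMod p → R}
    (hf : Function.Odd f) :
    2 * ∑ n ∈ Finset.Icc 1 ((p - 1) / 2), f ((n : ZMod p) ^ 2) =
      ∑ k, (quadraticChar (ZMod p) k : R) * f k := by
  have hodd : Odd p := (Fact.out : p.Prime).odd_of_ne_two hp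
  have hsq := sum_comp_sq_eq_sum_quadraticChar_add_one_mul (by rwa [ZMod.ringChar_zmod_n]) f
  rw [sum_eq_add_two_nsmul_sum_Icc_of_even hodd fun x => by rw [neg_sq], zero_pow two_ne_zero,
    hf.map_zero, zero_add, nsmul_eq_mul] at hsq
  simpa [add_mul, Finset.sum_add_distrib, hf.sum_eq_zero] using hsq

lemma quadraticChar_two_eq_neg_one (hp : p % 8 = 3) : quadraticChar (ZMod p) 2 = -1 := by
  rw [quadraticChar_two (by rw [ZMod.ringChar_zmod_n]; rintro rfl; simp at hp), ZMod.card,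
    ZMod.χ₈_nat_eq_if_mod_eight, if_neg (by omega), if_neg (by omega)]

end QuadraticSums

section TangentAndCotangentSums

lemma cot_add_nat_mul_pi (y : ℝ) (q : ℕ) : Real.cot (y + q * Real.pi) = Real.cot y := by
  rw [Real.cot_eq_cos_div_sin, Real.cot_eq_cos_div_sin, Real.cos_add_nat_mul_pi,
    Real.sin_add_nat_mul_pi, mul_div_mul_left _ _ (by simp)]

lemma tan_eq_cot_sub_two_mul_cot_two_mul (y : ℝ) :
    Real.tan y = Real.cot y - 2 * Real.cot (2 * y) := by
  rw [Real.cot_eq_cos_div_sin, Real.cot_eq_cos_div_sin, Real.tan_eq_sin_div_cos,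
    Real.sin_two_mul, Real.cos_two_mul']
  rcases eq_or_ne (Real.sin y) 0 with hs | hs
  · simp [hs]
  rcases eq_or_ne (Real.cos y) 0 with hc | hc
  · simp [hc]
  field_simp
  ring

lemma cotRes_natCast {N : ℕ} [NeZero N] (a : ℕ) :
    cotRes N (a : ZMod N) = Real.cot (Real.pi * a / N) := by
  have hN : (N : ℝ) ≠ 0 := NeZero.ne _
  have hdiv : (a : ℝ) = (a % N : ℕ) + (N : ℝ) * (a / N : ℕ) := by
    exact_mod_cast (Nat.mod_add_div a N).symm
  rw [cotRes, ZMod.val_natCast, ← cot_add_nat_mul_pi _ (a / N)]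
  congr 1
  rw [hdiv]
  field_simp

lemma cotRes_odd {N : ℕ} [NeZero N] : Function.Odd (cotRes N) := by
  intro k
  rcases eq_or_ne k 0 with rfl | hk
  · simp [cotRes, Real.cot_eq_cos_div_sin]
  · rw [cotRes, ZMod.neg_val, if_neg hk, Nat.cast_sub (ZMod.val_lt k).le, mul_sub, sub_div,
      mul_div_cancel_right₀ _ (NeZero.ne (N : ℝ)), Real.cot_eq_cos_div_sin, Real.cos_pi_sub,
      Real.sin_pi_sub, neg_div, ← Real.cot_eq_cos_div_sin, cotRes]

variable {p : ℕ} [Fact p.Prime]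

lemma two_mul_cotSum (hp : p ≠ 2) :
    2 * cotSum p = √p * ∑ k : ZMod p, (quadraticChar (ZMod p) k : ℝ) * cotRes p k := by
  rw [← two_mul_sum_Icc_comp_sq hp cotRes_odd, cotSum, mul_left_comm]
  simp only [← Nat.cast_pow, cotRes_natCast]

lemma tanSum_eq_mul_cotSum (hp : p ≠ 2) :
    tanSum p = (1 - 2 * quadraticChar (ZMod p) 2) * cotSum p := by
  have htwo : (2 : ZMod p) ≠ 0 := Ring.two_ne_zero (by rwa [ZMod.ringChar_zmod_n])
  have hdouble : 2 * ∑ n ∈ Finset.Icc 1 ((p - 1) / 2), cotRes p (2 * (n : ZMod p) ^ 2) =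
      quadraticChar (ZMod p) 2 * ∑ k, (quadraticChar (ZMod p) k : ℝ) * cotRes p k := by
    rw [← sum_quadraticChar_mul_comp_mul_left htwo, ← two_mul_sum_Icc_comp_sq hp]
    exact fun k => by rw [mul_neg, cotRes_odd]
  have htan (n : ℕ) : Real.tan (Real.pi * n ^ 2 / p) =
      Real.cot (Real.pi * n ^ 2 / p) - 2 * cotRes p (2 * (n : ZMod p) ^ 2) := by
    have := cotRes_natCast (N := p) (2 * n ^ 2)
    push_cast at this
    rw [tan_eq_cot_sub_two_mul_cot_two_mul, this]
    ring_nf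
  simp only [tanSum, htan, Finset.sum_sub_distrib, ← Finset.mul_sum, hdouble]
  rw [mul_sub, ← cotSum]
  linear_combination (quadraticChar (ZMod p) 2 : ℝ) * two_mul_cotSum hp

end TangentAndCotangentSums

section FirstMoment
open ZMod

lemma neg_val_odd_iff {N : ℕ} [NeZero N] (hN : Odd N) {k : ZMod N} (hk : k ≠ 0) :
    Odd (-k).val ↔ ¬Odd k.val := by
  have := k.val_lt
  rw [neg_val, if_neg hk]
  grind

/-- The sign of the parity of the least nonnegative residue of `k`: `1` if it is odd, `-1` if it is
even, with `0` at `k = 0` so that the function is odd for odd `N`. -/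
def paritySign (N : ℕ) (k : ZMod N) : ℤ := if k = 0 then 0 else if Odd k.val then 1 else -1

lemma paritySign_odd {N : ℕ} [NeZero N] (hN : Odd N) : Function.Odd (paritySign N) := by
  intro k
  rcases eq_or_ne k 0 with rfl | hk
  · simp [paritySign]
  · simp only [paritySign, neg_eq_zero, hk, if_false, neg_val_odd_iff hN hk]
    split_ifs <;> rfl

lemma mul_paritySign_two_mul {N : ℕ} [NeZero N] (hN : Odd N) {k : ZMod N} (hk : 2 * k ≠ 0) :
    N * paritySign N (2 * k) = 4 * k.val - 2 * (2 * k).val - N := by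
  rw [paritySign, if_neg hk, two_mul]
  rcases lt_or_ge (k.val + k.val) N with h | h
  · rw [val_add_of_lt h, if_neg (by grind)]
    push_cast
    ring
  · have hval := val_add_val_of_le h
    have : (k.val : ℤ) + k.val = (k + k).val + N := by exact_mod_cast hval
    rw [if_pos (by grind)]
    linarith

variable {p : ℕ} [Fact p.Prime]

variable (p) in
/-- The first moment `∑ j χ(j)`, over `0 ≤ j < p`, of the quadratic character `χ` modulo `p`; the
sums of the theorem are all rational multiples of it. -/
def charMoment : ℤ := ∑ j : ZMod p, quadraticChar (ZMod p) j * (j.val : ℤ)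

lemma quadCharC_isPrimitive (hp : p ≠ 2) : (quadCharC p).IsPrimitive :=
  ((Fact.out : p.Prime).eq_one_or_self_of_dvd _ (quadCharC p).conductor_dvd_level).resolve_left
    ((quadCharC p).eq_one_iff_conductor_eq_one.not.1 (quadCharC_ne_one hp))

lemma quadCharC_odd (hp : p % 4 = 3) : (quadCharC p).Odd := by
  rw [DirichletCharacter.Odd, quadCharC_apply, quadraticChar_neg_one, ZMod.card,
    χ₄_nat_three_mod_four hp, Int.cast_neg, Int.cast_one]
  rw [ringChar_zmod_n]
  omega

lemma sqrt_mul_sum_quadraticChar_mul_cotRes (hp : p % 4 = 3) :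
    √p * ∑ k : ZMod p, (quadraticChar (ZMod p) k : ℝ) * cotRes p k = -2 * charMoment p := by
  have hp2 : p ≠ 2 := by omega
  have hp0 : (p : ℂ) ≠ 0 := NeZero.ne _
  have hsum := sum_mul_cotRes_of_isPrimitive (quadCharC_isPrimitive hp2) (quadCharC_odd hp)
  rw [quadCharC_isQuadratic.inv, gaussSum_quadCharC hp2, if_neg (by omega)] at hsum
  have hsqrt : (√p : ℂ) * √p = p := by norm_cast; exact Real.mul_self_sqrt p.cast_nonneg
  suffices (√p : ℂ) * ∑ k, quadCharC p k * cotRes p k = -2 * charMoment p by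
    simp only [quadCharC_apply] at this
    exact_mod_cast this
  rw [hsum, charMoment]
  push_cast [quadCharC_apply]
  field_simp
  linear_combination (∑ j : ZMod p, (quadraticChar (ZMod p) j : ℂ) * j.val) *
    (Complex.I ^ 2 * hsqrt + p * Complex.I_sq)

theorem cotSum_eq_neg_charMoment (hp : p % 4 = 3) : cotSum p = -charMoment p := by
  linarith [two_mul_cotSum (p := p) (by omega), sqrt_mul_sum_quadraticChar_mul_cotRes hp]

theorem charMoment_neg (hp : p % 4 = 3) : charMoment p < 0 := by
  have hpos : 0 < ∑ k : ZMod p, (quadraticChar (ZMod p) k : ℝ) * cotRes p k := by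
    have := sum_mul_cotRes_pos_of_isQuadratic quadCharC_isQuadratic (quadCharC_odd hp)
    simp only [quadCharC_apply] at this
    exact_mod_cast this
  have hp0 : (0 : ℝ) < p := Nat.cast_pos'.2 (NeZero.pos p)
  have hmul := mul_pos (Real.sqrt_pos.2 hp0) hpos
  rw [sqrt_mul_sum_quadraticChar_mul_cotRes hp] at hmul
  exact_mod_cast (by linarith : (charMoment p : ℝ) < 0)

end FirstMoment

section ResidueCounts
open ZMod

variable {p : ℕ} [Fact p.Prime]

open Classical in
lemma oddResidues_sub_evenResidues :
    (oddResidues p : ℤ) - evenResidues p = ∑ k with IsSquare k, paritySign p k := by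
  rw [Finset.sum_filter, sum_eq_sum_range_natCast, Finset.range_eq_Ico,
    Finset.sum_eq_sum_Ico_succ_bot (NeZero.pos p), oddResidues, evenResidues, Finset.card_filter,
    Finset.card_filter, Nat.cast_sum, Nat.cast_sum, ← Finset.sum_sub_distrib]
  have hIcc : Finset.Icc 1 (p - 1) = Finset.Ico (0 + 1) p := by
    ext n; simp; have := NeZero.pos p; omega
  simp only [hIcc, paritySign, Nat.cast_zero, if_true, ite_self, zero_add]
  refine Finset.sum_congr rfl fun n hn => ?_
  obtain ⟨hn1, hnp⟩ := Finset.mem_Ico.1 hn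
  have hval : (n : ZMod p).val = n := val_cast_of_lt hnp
  have hne : (n : ZMod p) ≠ 0 := (val_ne_zero _).1 (by omega)
  rw [if_neg hne, hval]
  by_cases hsq : IsSquare (n : ZMod p) <;> by_cases hodd : Odd n <;>
    simp [hsq, hodd, ← Nat.not_odd_iff_even]

lemma mul_sum_quadraticChar_mul_paritySign (hp : p ≠ 2) :
    p * ∑ k : ZMod p, quadraticChar (ZMod p) k * paritySign p k =
      2 * (2 * quadraticChar (ZMod p) 2 - 1) * charMoment p := by
  have htwo : (2 : ZMod p) ≠ 0 := Ring.two_ne_zero (by rwa [ringChar_zmod_n])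
  have hodd : Odd p := (Fact.out : p.Prime).odd_of_ne_two hp
  have hterm (k : ZMod p) : p * (quadraticChar (ZMod p) k * paritySign p (2 * k)) =
      4 * (quadraticChar (ZMod p) k * k.val) - 2 * (quadraticChar (ZMod p) k * (2 * k).val) -
        p * quadraticChar (ZMod p) k := by
    rcases eq_or_ne k 0 with rfl | hk
    · simp
    · linear_combination
        quadraticChar (ZMod p) k * mul_paritySign_two_mul hodd (mul_ne_zero htwo hk)
  have hsum := Finset.sum_congr rfl fun k (_ : k ∈ Finset.univ) => hterm k
  have hsign := sum_quadraticChar_mul_comp_mul_left htwo (paritySign p)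
  have hval := sum_quadraticChar_mul_comp_mul_left htwo fun k => (k.val : ℤ)
  simp only [Int.cast_id] at hsign hval
  simp only [Finset.sum_sub_distrib, ← Finset.mul_sum, hsign, hval,
    quadraticChar_sum_zero (F := ZMod p) (by rwa [ringChar_zmod_n])] at hsum
  have hsq : quadraticChar (ZMod p) 2 ^ 2 = 1 := quadraticChar_sq_one htwo
  rw [← charMoment] at hsum
  generalize ∑ k, quadraticChar (ZMod p) k * paritySign p k = S at hsum ⊢
  linear_combination quadraticChar (ZMod p) 2 * hsum - (p * S + 2 * charMoment p) * hsq

theorem mul_oddResidues_sub_evenResidues (hp : p ≠ 2) :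
    p * ((oddResidues p : ℤ) - evenResidues p) =
      (2 * quadraticChar (ZMod p) 2 - 1) * charMoment p := by
  classical
  have hodd : Odd p := (Fact.out : p.Prime).odd_of_ne_two hp
  have hsquares := sum_quadraticChar_mul_eq_two_mul_sum_isSquare (paritySign_odd hodd)
  have hmoment := mul_sum_quadraticChar_mul_paritySign hp
  simp only [Int.cast_id] at hsquares
  rw [hsquares] at hmoment
  rw [oddResidues_sub_evenResidues]
  linarith

end ResidueCounts

section MomentArithmetic

variable {p : ℕ} [Fact p.Prime]

lemma two_mul_sum_val {N : ℕ} [NeZero N] : 2 * ∑ j : ZMod N, (j.val : ℤ) = N * (N - 1) := by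
  rw [sum_eq_sum_range_natCast, Finset.sum_congr rfl fun n hn => by
    rw [ZMod.val_cast_of_lt (Finset.mem_range.1 hn)], mul_comm, ← Nat.cast_sum,
    ← Nat.cast_pred (NeZero.pos N)]
  exact_mod_cast Finset.sum_range_id_mul_two N

lemma charMoment_odd (hp : p % 4 = 3) : Odd (charMoment p) := by
  have hmod : Even (charMoment p - ∑ j : ZMod p, (j.val : ℤ)) := by
    rw [charMoment, ← Finset.sum_sub_distrib]
    refine Finset.even_sum _ fun j _ => ?_
    rcases eq_or_ne j 0 with rfl | hj
    · simp
    · rcases quadraticChar_dichotomy hj with h | h <;> rw [h]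
      · simp
      · exact ⟨-j.val, by ring⟩
  have hsum : Odd (∑ j : ZMod p, (j.val : ℤ)) := by
    obtain ⟨t, rfl⟩ : ∃ t, p = 4 * t + 3 := ⟨p / 4, by omega⟩
    have h := two_mul_sum_val (N := 4 * t + 3)
    push_cast at h
    exact ⟨4 * t ^ 2 + 5 * t + 1, by linarith⟩
  simpa using hmod.add_odd hsum

lemma dvd_charMoment (hp3 : 3 < p) : (p : ℤ) ∣ charMoment p := by
  have hodd : Odd p := (Fact.out : p.Prime).odd_of_ne_two (by omega)
  rw [← ZMod.intCast_zmod_eq_zero_iff_dvd, charMoment, Int.cast_sum,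
    ← FiniteField.sum_pow_lt_card_sub_one (ZMod p) (p / 2 + 1) (by rw [ZMod.card]; grind)]
  refine Finset.sum_congr rfl fun j _ => ?_
  rw [Int.cast_mul, quadraticChar_eq_pow_of_char_ne_two' (by rw [ZMod.ringChar_zmod_n]; omega),
    ZMod.card, pow_succ]
  simp

lemma neg_charMoment_lt_sq : -charMoment p < p ^ 2 := by
  have hle : -charMoment p ≤ ∑ j : ZMod p, (j.val : ℤ) := by
    rw [charMoment, ← Finset.sum_neg_distrib]
    refine Finset.sum_le_sum fun j _ => ?_
    rcases quadraticChar_isQuadratic (ZMod p) j with h | h | h <;> rw [h] <;> linarith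
  have hp0 : (0 : ℤ) < p := by exact_mod_cast NeZero.pos p
  nlinarith [two_mul_sum_val (N := p)]

end MomentArithmetic

lemma cotSum_three : cotSum 3 = 1 := by
  have hcot : Real.cot (Real.pi / 3) = 1 / √3 := by
    rw [Real.cot_eq_cos_div_sin, Real.cos_pi_div_three, Real.sin_pi_div_three]
    field_simp
  simp [cotSum, hcot]

section Theorems

variable {p : ℕ} [Fact p.Prime]

theorem exists_cotSum_eq_natCast (hp : p % 4 = 3) (hp3 : 3 < p) :
    ∃ c : ℕ, cotSum p = c ∧ Odd c ∧ 0 < c ∧ p ∣ c ∧ ¬p ^ 2 ∣ c := by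
  obtain ⟨c, hc⟩ := Int.eq_ofNat_of_zero_le (neg_nonneg.2 (charMoment_neg hp).le)
  have hpos : 0 < c := by have := charMoment_neg hp; omega
  refine ⟨c, ?_, ?_, hpos, ?_, fun hsq => ?_⟩
  · rw [cotSum_eq_neg_charMoment hp]
    exact_mod_cast hc
  · exact_mod_cast hc ▸ (charMoment_odd hp).neg
  · exact_mod_cast hc ▸ (dvd_charMoment hp3).neg_right
  · have hlt : (c : ℤ) < p ^ 2 := hc ▸ neg_charMoment_lt_sq
    exact (Nat.le_of_dvd hpos hsq).not_gt (by exact_mod_cast hlt)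

theorem tanSum_eq_neg_three_mul_charMoment (hp : p % 8 = 3) :
    tanSum p = (3 * -charMoment p : ℤ) := by
  rw [tanSum_eq_mul_cotSum (by omega), cotSum_eq_neg_charMoment (by omega),
    quadraticChar_two_eq_neg_one hp]
  push_cast
  ring

theorem exists_oddResidues_sub_evenResidues_eq_three_mul (hp : p % 8 = 3) (hp3 : 3 < p) :
    ∃ m : ℕ, 0 < m ∧ (oddResidues p : ℤ) - evenResidues p = 3 * m := by
  have hp0 : (0 : ℤ) < p := by exact_mod_cast NeZero.pos p
  obtain ⟨k, hk⟩ := dvd_charMoment hp3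
  have hkneg : k < 0 := neg_of_mul_neg_right (hk ▸ charMoment_neg (by omega)) hp0.le
  have hcount := mul_oddResidues_sub_evenResidues (p := p) (by omega)
  rw [quadraticChar_two_eq_neg_one hp, hk, mul_left_comm] at hcount
  refine ⟨k.natAbs, by omega, ?_⟩
  rw [mul_left_cancel₀ hp0.ne' hcount]
  omega

end Theorems

theorem mainTheorem4 :
    cotSum 3 = 1 ∧
    (∀ p : ℕ, p.Prime → p % 4 = 3 → 3 < p →
      ∃ c : ℕ, cotSum p = (c : ℝ) ∧ Odd c ∧ 0 < c ∧ p ∣ c ∧ ¬ p ^ 2 ∣ c) ∧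
    (∀ p : ℕ, p.Prime → p % 8 = 3 → ∃ t : ℤ, tanSum p = ((3 * t : ℤ) : ℝ)) ∧
    (∀ p : ℕ, p.Prime → p % 8 = 3 → 3 < p →
      ∃ m : ℕ, 0 < m ∧ (oddResidues p : ℤ) - (evenResidues p : ℤ) = 3 * (m : ℤ)) := by
  refine ⟨cotSum_three, fun p hprime hp hp3 => ?_, fun p hprime hp => ?_,
    fun p hprime hp hp3 => ?_⟩ <;> have : Fact p.Prime := ⟨hprime⟩
  · exact exists_cotSum_eq_natCast hp hp3
  · exact ⟨-charMoment p, tanSum_eq_neg_three_mul_charMoment hp⟩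
  · exact exists_oddResidues_sub_evenResidues_eq_three_mul hp hp3
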